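/- Let $q$ be a prime power, let $0\le k\le n$ and $r\ge 1$ be integers, and read "space" throughout either as "vector space over $\mathbb F_q$" or throughout as "affine space over $\mathbb F_q$", where an affine space is a subset of an $\mathbb F_q$-vector space closed under affine combinations (the empty set is allowed). The rank of a space is the number of elements of a basis (a linear basis for vector spaces, an affine basis for affine spaces, so that a nonempty affine space has rank one more than its dimension and the empty affine space has rank $0$). A $k$-space is a space of rank $k$, and $\binom{U}{k}_q$ denotes the set of all $k$-subspaces of a space $U$. An isomorphism of spaces is a bijection that preserves linear (respectively affine) combinations. In both cases the following holds. For every $n$-space $C$ and every family $\mathcal F\subseteq\binom{C}{k}_q$ there exist an integer $N$, an $N$-space $X$ and a family $\mathcal H\subseteq\binom{X}{k}_q$ such that for every coloring of the members of $\mathcal H$ with $r$ colors there is an $n$-subspace $U$ of $X$ for which all members of $\binom{U}{k}_q\cap\mathcal H$ have the same color and for which there is an isomorphism $\varphi\colon C\to U$ with $$\{\varphi(F): F\in\mathcal F\}=\binom{U}{k}_q\cap\mathcal H .$$ -/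

import Mathlib

namespace SpaceRamsey

section Vector

variable (K : Type*) {V : Type*} [Field K] [AddCommGroup V] [Module K V]

/-- The set of all `k`-subspaces of a linear subspace `U`: the linear subspaces of `U` that have
linear rank `k`. -/
def vectorSubspaces (U : Submodule K V) (k : ℕ) : Set (Submodule K V) :=
  {W | W ≤ U ∧ Module.rank K W = (k : Cardinal)}

end Vector

section Affine

variable (K : Type*) {V V' : Type*} [Field K] [AddCommGroup V] [Module K V]
  [AddCommGroup V'] [Module K V']

/-- The affine space `W` has rank `k`: it has an affine basis with `k` elements. Thus the empty
affine space has rank `0`, a point has rank `1`, a line has rank `2`, and so on. -/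
def HasAffineRank (W : AffineSubspace K V) (k : ℕ) : Prop :=
  ∃ b : Fin k → V, AffineIndependent K b ∧ affineSpan K (Set.range b) = W

/-- The set of all `k`-subspaces of an affine space `U`: the affine subspaces of `U` that have
affine rank `k`. -/
def affineSubspaces (U : AffineSubspace K V) (k : ℕ) : Set (AffineSubspace K V) :=
  {W | W ≤ U ∧ HasAffineRank K W k}

/-- The affine map `φ` restricts to an isomorphism (a bijection preserving affine combinations)
from the affine space `C` onto the affine space `U`. Every isomorphism from `C` to `U` arises in
this way, since an affine map defined on an affine subspace extends to the surrounding space. -/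
def IsAffineIsoOn (φ : V →ᵃ[K] V') (C : AffineSubspace K V) (U : AffineSubspace K V') : Prop :=
  Set.InjOn φ (C : Set V) ∧ C.map φ = U

end Affine

/-- A coloring `c` of the family `H` is constant on the members of `H` that lie in `S`. -/
def IsMonochromaticOn {α : Type*} {H : Set α} {r : ℕ} (c : H → Fin r) (S : Set α) : Prop :=
  ∃ a : Fin r, ∀ W : H, (W : α) ∈ S → c W = a

end SpaceRamsey

/-! Both versions follow from one statement about linear spaces over a fixed base `L`, that is,
spaces with a linear map to `L`, where only `k`-subspaces mapping onto `L` are considered. For `L =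
0` these are all `k`-subspaces. For `L = K` they correspond to the nonempty affine subspaces of the
hyperplane `μ = 1`, with linear rank equal to affine rank.

The engine is Hales–Jewett with linear maps `X → Q` as letters (`exists_fillPattern_mono`): a word
is a linear map `X → Q ^ ι`, and along a suitable line the colour of the graph of a word over `B`
depends on `B` alone.

The non-induced theorem (`ramseyOver`) goes by induction on `k`. A subspace of `X × K` is a cylinder
over a subspace of rank one less, or a graph over one of equal rank. Cylinders are made
monochromatic by the case `k`, graphs by an inner induction on the sum of the dimensions requested
for the colours.

The induced theorem (`exists_induced_ramsey`) takes such an `X` for `C` and applies Hales–Jewett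
once more, with only those letters that cannot agree with a tautological copy of `C` on a
`k`-subspace outside `F`. The family `H` consists of the graphs of words in these letters. An active
coordinate of the line then prevents subspaces outside `F` from landing in `H`. -/

namespace SpaceRamsey

/-! ### Hales–Jewett with linear maps as letters -/

section HalesJewett

variable {K : Type*} [Field K] {X Q ι : Type*} [AddCommGroup X] [Module K X]
  [AddCommGroup Q] [Module K Q]

/-- The linear map `X × Q → X × Q ^ ι` over `X` attached to a pattern `σ`: the coordinates with
`σ i = none` carry a copy of `Q`, the others are prescribed linear functions on `X`. -/
def fillPattern {S : Set (X →ₗ[K] Q)} (σ : ι → Option S) : X × Q →ₗ[K] X × (ι → Q) :=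
  (LinearMap.fst K X Q).prod (LinearMap.pi fun i =>
    (σ i).elim (LinearMap.snd K X Q) fun s => s.1 ∘ₗ LinearMap.fst K X Q)

theorem fst_fillPattern {S : Set (X →ₗ[K] Q)} (σ : ι → Option S) (p : X × Q) :
    (fillPattern σ p).1 = p.1 := rfl

theorem fillPattern_snd_of_eq_none {S : Set (X →ₗ[K] Q)} {σ : ι → Option S} {i : ι}
    (hi : σ i = none) (p : X × Q) : (fillPattern σ p).2 i = p.2 := by
  simp [fillPattern, hi]

theorem fillPattern_injective {S : Set (X →ₗ[K] Q)} {σ : ι → Option S} (hσ : ∃ i, σ i = none) :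
    Function.Injective (fillPattern σ) := by
  obtain ⟨i, hi⟩ := hσ
  intro p q h
  refine Prod.ext ?_ ?_
  · rw [← fst_fillPattern σ p, ← fst_fillPattern σ q, h]
  · rw [← fillPattern_snd_of_eq_none hi p, ← fillPattern_snd_of_eq_none hi q, h]

theorem fillPattern_comp_graph {S : Set (X →ₗ[K] Q)} (σ : ι → Option S) (s : S) :
    fillPattern σ ∘ₗ LinearMap.id.prod s.1 =
      LinearMap.id.prod (LinearMap.pi fun i => ((σ i).getD s).1) := by
  refine LinearMap.ext fun x => Prod.ext rfl (funext fun i => ?_)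
  cases h : σ i <;> simp [fillPattern, h]

instance finite_submodule [Finite X] : Finite (Submodule K X) :=
  Finite.of_injective _ SetLike.coe_injective

instance finite_linearMap [Finite X] [Finite Q] : Finite (X →ₗ[K] Q) :=
  Finite.of_injective _ DFunLike.coe_injective

/-- Hales–Jewett for graphs of linear maps: in a large power of `Q`, the colour of the graph of a
word of linear maps over `B` can be made to depend on `B` only. -/
theorem exists_fillPattern_mono [Finite X] [Finite Q] (S : Set (X →ₗ[K] Q)) (κ : Type*)
    [Finite κ] :
    ∃ (ι : Type) (_ : Fintype ι), ∀ χ : Submodule K (X × (ι → Q)) → κ,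
      ∃ σ : ι → Option S, (∃ i, σ i = none) ∧ ∃ χ₀ : Submodule K X → κ,
        ∀ s ∈ S, ∀ B : Submodule K X,
          χ (B.map (fillPattern σ ∘ₗ LinearMap.id.prod s)) = χ₀ B := by
  -- A word is coloured by the whole function of `B`, one of finitely many since `X` is finite, so a
  -- single line serves all `B` at once.
  obtain ⟨ι, hι, h⟩ := Combinatorics.Line.exists_mono_in_high_dimension S (Submodule K X → κ)
  refine ⟨ι, hι, fun χ => ?_⟩
  obtain ⟨l, χ₀, hl⟩ := h fun w B => χ (B.map (LinearMap.id.prod (LinearMap.pi fun i => (w i).1)))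
  refine ⟨l.idxFun, l.proper, χ₀, fun s hs B => ?_⟩
  rw [fillPattern_comp_graph l.idxFun ⟨s, hs⟩, ← hl ⟨s, hs⟩]
  rfl

end HalesJewett

/-! ### Graphs and cylinders -/

section Graph

variable {K : Type*} [Field K] {X Q : Type*} [AddCommGroup X] [Module K X]
  [AddCommGroup Q] [Module K Q]

/-- A subspace of `X × Q` that projects injectively to `X` is the graph of a linear map over its
projection. -/
theorem exists_eq_map_graph (W : Submodule K (X × Q)) (hW : ∀ q : Q, ((0, q) : X × Q) ∈ W → q = 0) :
    ∃ s : X →ₗ[K] Q, W = (W.map (LinearMap.fst K X Q)).map (LinearMap.id.prod s) := by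
  have hinj : Function.Injective (LinearMap.fst K X Q ∘ₗ W.subtype) := by
    rw [injective_iff_map_eq_zero]
    rintro ⟨⟨x, q⟩, hw⟩ hx
    obtain rfl : x = 0 := hx
    simp [hW q hw]
  obtain ⟨g, hg⟩ := LinearMap.exists_leftInverse_of_injective _ (LinearMap.ker_eq_bot.2 hinj)
  have key : ∀ w ∈ W, LinearMap.snd K X Q (g w.1 : X × Q) = w.2 := fun w hw => by
    have := LinearMap.congr_fun hg ⟨w, hw⟩
    simp only [LinearMap.comp_apply, Submodule.subtype_apply, LinearMap.fst_apply,
      LinearMap.id_apply] at this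
    simp [this]
  refine ⟨LinearMap.snd K X Q ∘ₗ W.subtype ∘ₗ g, le_antisymm (fun w hw => ?_) ?_⟩
  · exact ⟨w.1, ⟨w, hw, rfl⟩, Prod.ext rfl (key w hw)⟩
  · rintro _ ⟨_, ⟨w, hw, rfl⟩, rfl⟩
    have : LinearMap.id.prod (LinearMap.snd K X Q ∘ₗ W.subtype ∘ₗ g) (LinearMap.fst K X Q w) = w :=
      Prod.ext rfl (key w hw)
    rwa [this]

/-- A subspace of `X × K` that contains a nonzero vertical vector is a cylinder. -/
theorem eq_prod_top_of_mem (W : Submodule K (X × K)) {t : K} (ht : t ≠ 0)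
    (h : ((0, t) : X × K) ∈ W) : W = (W.map (LinearMap.fst K X K)).prod ⊤ := by
  refine le_antisymm (fun w hw => ⟨⟨w, hw, rfl⟩, trivial⟩) ?_
  rintro ⟨x, u⟩ ⟨⟨w, hw, rfl⟩, -⟩
  have := W.add_mem hw (W.smul_mem ((u - w.2) / t) h)
  convert this using 1
  refine Prod.ext ?_ ?_ <;> simp [ht]

end Graph

/-! ### Monochromatic embeddings over a base -/

section OverBase

variable {K : Type*} [Field K] {L C D X κ : Type*} [AddCommGroup L] [Module K L]
  [AddCommGroup C] [Module K C] [AddCommGroup D] [Module K D] [AddCommGroup X] [Module K X]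

/-- `e` is an embedding of spaces over `L` such that all the `k`-subspaces of its range
that map onto `L` have colour `a`. -/
structure IsMonoEmbedding (μ : C →ₗ[K] L) (ν : X →ₗ[K] L) (k : ℕ) (χ : Submodule K X → κ) (a : κ)
    (e : C →ₗ[K] X) : Prop where
  injective : Function.Injective e
  comp_eq : ν ∘ₗ e = μ
  color_eq : ∀ W : Submodule K C, W.map μ = ⊤ → Module.finrank K W = k → χ (W.map e) = a

theorem finrank_map_of_injective {e : C →ₗ[K] X} (he : Function.Injective e) (W : Submodule K C) :
    Module.finrank K (W.map e) = Module.finrank K W :=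
  (LinearEquiv.finrank_eq (Submodule.equivMapOfInjective e he W)).symm

theorem IsMonoEmbedding.comp {μ : C →ₗ[K] L} {ν : X →ₗ[K] L} {k : ℕ} {χ : Submodule K X → κ}
    {a : κ} {e : C →ₗ[K] X} (h : IsMonoEmbedding μ ν k χ a e) {g : D →ₗ[K] C}
    (hg : Function.Injective g) : IsMonoEmbedding (μ ∘ₗ g) ν k χ a (e ∘ₗ g) where
  injective := h.injective.comp hg
  comp_eq := by rw [← LinearMap.comp_assoc, h.comp_eq]
  color_eq W hW hk := by
    rw [Submodule.map_comp]
    exact h.color_eq _ (by rw [← Submodule.map_comp, hW]) (by rw [finrank_map_of_injective hg, hk])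

theorem finrank_eq_of_mem_vertical [Finite C] (W : Submodule K (C × K)) {t : K}
    (ht : t ≠ 0) (h : ((0, t) : C × K) ∈ W) :
    Module.finrank K W = Module.finrank K (W.map (LinearMap.fst K C K)) + 1 := by
  conv_lhs => rw [eq_prod_top_of_mem W ht h]
  let f : (W.map (LinearMap.fst K C K)).prod (⊤ : Submodule K K) ≃ₗ[K]
      W.map (LinearMap.fst K C K) × K :=
    { toFun p := (⟨p.1.1, p.2.1⟩, p.1.2)
      map_add' _ _ := rfl
      map_smul' _ _ := rfl
      invFun p := ⟨(p.1.1, p.2), p.1.2, trivial⟩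
      left_inv _ := rfl
      right_inv _ := rfl }
  rw [f.finrank_eq, Module.finrank_prod, Module.finrank_self]

/-- A subspace is either a cylinder or a graph, so colourings of both kinds together control the
colouring of the extended embedding. -/
theorem isMonoEmbedding_fillPattern [Finite C] [Finite K] {ι : Type*} {μ : C →ₗ[K] L}
    {ν : X →ₗ[K] L} {k : ℕ} {χ : Submodule K (X × (ι → K)) → κ} {a : κ}
    {σ : ι → Option (Set.univ : Set (X →ₗ[K] K))} (hσ : ∃ i, σ i = none)
    {χ₀ : Submodule K X → κ}
    (hχ : ∀ s ∈ (Set.univ : Set (X →ₗ[K] K)), ∀ B : Submodule K X,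
      χ (B.map (fillPattern σ ∘ₗ LinearMap.id.prod s)) = χ₀ B)
    {e : C →ₗ[K] X}
    (h₁ : IsMonoEmbedding μ ν k (fun W => χ ((W.prod ⊤).map (fillPattern σ))) a e)
    (h₀ : IsMonoEmbedding μ ν (k + 1) χ₀ a e) :
    IsMonoEmbedding (μ ∘ₗ LinearMap.fst K C K) (ν ∘ₗ LinearMap.fst K X (ι → K)) (k + 1) χ a
      (fillPattern σ ∘ₗ e.prodMap LinearMap.id) where
  injective := (fillPattern_injective hσ).comp
    (Prod.map_injective.2 ⟨h₁.injective, Function.injective_id⟩)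
  comp_eq := by
    rw [← h₁.comp_eq]
    rfl
  color_eq W hW hk := by
    rw [Submodule.map_comp] at hW
    -- A cylinder has a base of rank `k`, governed by `h₁`; a graph has a base of rank `k + 1`,
    -- governed by `h₀`.
    by_cases hv : ∃ t : K, t ≠ 0 ∧ ((0, t) : C × K) ∈ W
    · obtain ⟨t, ht, htW⟩ := hv
      have hr := finrank_eq_of_mem_vertical W ht htW
      rw [← h₁.color_eq _ hW (by omega), Submodule.map_comp]
      congr 2
      conv_lhs => rw [eq_prod_top_of_mem W ht htW]
      rw [LinearMap.prodMap_map_prod, Submodule.map_id]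
    · push Not at hv
      have hW0 : ∀ t : K, ((0, t) : C × K) ∈ W → t = 0 := fun t h => by
        by_contra h'
        exact hv t h' h
      obtain ⟨s, hs⟩ := exists_eq_map_graph (W.map (e.prodMap LinearMap.id)) (by
        rintro t ⟨⟨c, u⟩, hw, hcu⟩
        obtain ⟨hc, rfl⟩ : e c = 0 ∧ u = t := by simpa using hcu
        obtain rfl : c = 0 := h₁.injective (by rw [hc, map_zero])
        exact hW0 _ hw)
      have hfst : (W.map (e.prodMap LinearMap.id)).map (LinearMap.fst K X K) =
          (W.map (LinearMap.fst K C K)).map e := by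
        rw [← Submodule.map_comp, ← Submodule.map_comp]
        rfl
      rw [Submodule.map_comp, hs, ← Submodule.map_comp, hχ s trivial, hfst]
      refine h₀.color_eq _ hW ?_
      rw [← hk]
      have hinj : Function.Injective (LinearMap.fst K C K ∘ₗ W.subtype) := by
        rw [injective_iff_map_eq_zero]
        rintro ⟨⟨c, t⟩, hw⟩ hc
        obtain rfl : c = 0 := hc
        simp [hW0 t hw]
      have := LinearMap.finrank_range_of_inj hinj
      rwa [LinearMap.range_comp, Submodule.range_subtype] at this

end OverBase

universe u v

/-! ### The Ramsey theorem over a base -/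

section Ramsey

variable {K L : Type u} [Field K] [AddCommGroup L] [Module K L] {κ : Type}

/-- The Ramsey statement over `L` for colourings of the `k`-subspaces with colours in `κ`. -/
def RamseyOver (K L : Type u) [Field K] [AddCommGroup L] [Module K L] (κ : Type) (k : ℕ) : Prop :=
  ∀ (C : Type u) [AddCommGroup C] [Module K C] [Finite C] (μ : C →ₗ[K] L),
    ∃ (X : Type u) (_ : AddCommGroup X) (_ : Module K X) (_ : Finite X) (ν : X →ₗ[K] L),
      ∀ χ : Submodule K X → κ, ∃ a e, IsMonoEmbedding μ ν k χ a e

/-- A subspace of rank at most that of `L` that maps onto `L` maps isomorphically. It is thus a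
graph over all of `L`, and Hales–Jewett with `B = ⊤` suffices. -/
theorem ramseyOver_of_le_finrank [Finite K] [Finite L] [Finite κ] {k : ℕ}
    (hk : k ≤ Module.finrank K L) : RamseyOver K L κ k := by
  intro C _ _ _ μ
  obtain ⟨ι, _, h⟩ := exists_fillPattern_mono (Set.univ : Set (L →ₗ[K] C)) κ
  refine ⟨L × (ι → C), _, _, inferInstance, LinearMap.fst K L (ι → C), fun χ => ?_⟩
  obtain ⟨σ, hσ, χ₀, hχ⟩ := h χ
  refine ⟨χ₀ ⊤, fillPattern σ ∘ₗ μ.prod LinearMap.id,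
    (fillPattern_injective hσ).comp fun x y hxy => congrArg Prod.snd hxy, rfl, fun W hW hWk => ?_⟩
  have hinj : Function.Injective (μ ∘ₗ W.subtype) := by
    have hsurj : LinearMap.range (μ ∘ₗ W.subtype) = ⊤ := by
      rw [LinearMap.range_comp, Submodule.range_subtype, hW]
    have h1 := LinearMap.finrank_range_add_finrank_ker (μ ∘ₗ W.subtype)
    rw [hsurj, finrank_top] at h1
    exact LinearMap.ker_eq_bot.1 (Submodule.finrank_eq_zero.1 (by omega))
  obtain ⟨s, hs⟩ := exists_eq_map_graph (W.map (μ.prod LinearMap.id)) (by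
    rintro q ⟨c, hc, hcq⟩
    obtain ⟨h0, rfl⟩ : μ c = 0 ∧ c = q := by simpa using hcq
    have := @hinj ⟨c, hc⟩ 0 (by simpa using h0)
    exact congrArg Subtype.val this)
  have hfst : (W.map (μ.prod LinearMap.id)).map (LinearMap.fst K L C) = ⊤ := by
    rw [← Submodule.map_comp, ← hW]
    rfl
  rw [Submodule.map_comp, hs, hfst, ← Submodule.map_comp, hχ s trivial]

/-- The copy of `L` has rank at most `k`, so the colour condition on rank `k + 1` is vacuous. -/
theorem exists_ramsey_of_dimension_eq_zero [Finite L] [Finite K] {k : ℕ}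
    (hk : Module.finrank K L ≤ k) {t : κ → ℕ} {a : κ} (ha : t a = 0) :
    ∃ (X : Type u) (_ : AddCommGroup X) (_ : Module K X) (_ : Finite X) (ν : X →ₗ[K] L),
      ∀ χ : Submodule K X → κ, ∃ a, ∃ e : (L × (Fin (t a) → K)) →ₗ[K] X,
        IsMonoEmbedding (LinearMap.fst K L (Fin (t a) → K)) ν (k + 1) χ a e := by
  refine ⟨L × (Fin (t a) → K), _, _, inferInstance, LinearMap.fst K L _, fun χ =>
    ⟨a, LinearMap.id, Function.injective_id, rfl, fun W _ hW => ?_⟩⟩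
  have := W.finrank_le
  rw [Module.finrank_prod, Module.finrank_fin_fun] at this
  omega

/-- Splits off the last coordinate of a vector. -/
def splitLast (K L : Type*) [Field K] [AddCommGroup L] [Module K L] (m : ℕ) :
    L × (Fin (m + 1) → K) →ₗ[K] (L × (Fin m → K)) × K :=
  ((LinearMap.fst K L _).prod (LinearMap.funLeft K K Fin.castSucc ∘ₗ LinearMap.snd K L _)).prod
    (LinearMap.proj (Fin.last m) ∘ₗ LinearMap.snd K L _)

theorem splitLast_injective (K L : Type*) [Field K] [AddCommGroup L] [Module K L] (m : ℕ) :
    Function.Injective (splitLast K L m) := by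
  rintro ⟨l, x⟩ ⟨l', x'⟩ h
  refine Prod.ext (congrArg (fun p => p.1.1) h) (funext fun i => ?_)
  refine Fin.lastCases (congrArg Prod.snd h) (fun i => ?_) i
  exact congrFun (congrArg (fun p => p.1.2) h) i

/-- The Ramsey statement over `L` with a prescribed dimension for each colour. -/
theorem exists_ramsey_of_dimensions [Finite K] [Finite L] [Fintype κ] {k : ℕ}
    (hk : Module.finrank K L ≤ k) (hR : RamseyOver K L κ k) (m : ℕ) :
    ∀ t : κ → ℕ, ∑ a, t a = m →
    ∃ (X : Type u) (_ : AddCommGroup X) (_ : Module K X) (_ : Finite X) (ν : X →ₗ[K] L),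
      ∀ χ : Submodule K X → κ, ∃ a, ∃ e : (L × (Fin (t a) → K)) →ₗ[K] X,
        IsMonoEmbedding (LinearMap.fst K L (Fin (t a) → K)) ν (k + 1) χ a e := by
  classical
  induction m with
  | zero =>
    intro t ht
    obtain h | ⟨⟨a⟩⟩ := isEmpty_or_nonempty κ
    · refine ⟨L, _, _, inferInstance, LinearMap.id, fun χ => h.elim (χ ⊤)⟩
    · exact exists_ramsey_of_dimension_eq_zero hk
        ((Finset.sum_eq_zero_iff.1 ht) a (Finset.mem_univ a))
  | succ m ih =>
    intro t ht
    by_cases h0 : ∃ a, t a = 0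
    · obtain ⟨a, ha⟩ := h0
      exact exists_ramsey_of_dimension_eq_zero hk ha
    push Not at h0
    have hdec : ∀ a, ∑ b, Function.update t a (t a - 1) b = m := fun a => by
      have h1 := Finset.add_sum_erase Finset.univ t (Finset.mem_univ a)
      have h2 := Finset.sum_update_of_mem (Finset.mem_univ a) t (t a - 1)
      rw [Finset.sdiff_singleton_eq_erase] at h2
      have := Nat.pos_of_ne_zero (h0 a)
      omega
    choose Y _ _ _ ν hY using fun a => ih _ (hdec a)
    -- The colour `a` of the cylinders is known only after `χ`, so a copy of every `Y a` over `L`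
    -- must be available in advance.
    obtain ⟨Z, _, _, _, νZ, hZ⟩ := hR (L × ∀ a, Y a) (LinearMap.fst K L _)
    obtain ⟨ι, _, hι⟩ := exists_fillPattern_mono (Set.univ : Set (Z →ₗ[K] K)) κ
    refine ⟨Z × (ι → K), _, _, inferInstance, νZ ∘ₗ LinearMap.fst K Z _, fun χ => ?_⟩
    obtain ⟨σ, hσ, χ₀, hχ⟩ := hι χ
    obtain ⟨a, e₁, h₁⟩ := hZ fun W => χ ((W.prod ⊤).map (fillPattern σ))
    let j : Y a →ₗ[K] L × ∀ a, Y a := (ν a).prod (LinearMap.single K Y a)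
    have hj : Function.Injective j := fun x y hxy => Pi.single_injective a (congrArg Prod.snd hxy)
    obtain ⟨b, e₂, h₂⟩ := hY a fun W => χ₀ (W.map (e₁ ∘ₗ j))
    have h₁' := (h₁.comp hj).comp h₂.injective
    have hmono : ∃ e : L × (Fin (Function.update t a (t a - 1) b) → K) →ₗ[K] Z,
        IsMonoEmbedding (LinearMap.fst K L _) νZ k
          (fun W => χ ((W.prod ⊤).map (fillPattern σ))) a e ∧
        IsMonoEmbedding (LinearMap.fst K L _) νZ (k + 1) χ₀ b e := by
      have h₁' := (h₁.comp hj).comp h₂.injective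
      rw [LinearMap.fst_prod, h₂.comp_eq] at h₁'
      refine ⟨_, h₁', h₁'.injective, h₁'.comp_eq, fun W hW hWk => ?_⟩
      rw [Submodule.map_comp]
      exact h₂.color_eq W hW hWk
    refine ⟨b, ?_⟩
    -- If `b = a`, cylinders and graphs share a colour, and the extra coordinate restores the
    -- dimension that was subtracted. Otherwise the dimension for `b` was never lowered, and the
    -- graph of the zero map suffices.
    by_cases hb : b = a
    · subst hb
      rw [Function.update_self] at hmono
      obtain ⟨u, hu⟩ := Nat.exists_eq_succ_of_ne_zero (h0 b)
      rw [hu, Nat.succ_sub_one] at hmono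
      rw [hu]
      obtain ⟨e, he₁, he₀⟩ := hmono
      exact ⟨_, (isMonoEmbedding_fillPattern hσ hχ he₁ he₀).comp (splitLast_injective K L u)⟩
    · rw [Function.update_of_ne hb] at hmono
      obtain ⟨e, -, he₀⟩ := hmono
      refine ⟨fillPattern σ ∘ₗ LinearMap.id.prod 0 ∘ₗ e, (fillPattern_injective hσ).comp
        fun x y hxy => he₀.injective (congrArg Prod.fst hxy), he₀.comp_eq, fun W hW hWk => ?_⟩
      rw [← LinearMap.comp_assoc, Submodule.map_comp, hχ 0 trivial]
      exact he₀.color_eq W hW hWk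

theorem ramseyOver_succ [Finite K] [Finite L] [Finite κ] {k : ℕ}
    (hk : Module.finrank K L ≤ k) (hR : RamseyOver K L κ k) : RamseyOver K L κ (k + 1) := by
  intro C _ _ _ μ
  have := Fintype.ofFinite κ
  obtain ⟨X, _, _, _, ν, h⟩ := exists_ramsey_of_dimensions hk hR _
    (fun _ : κ => Module.finrank K C) rfl
  refine ⟨X, _, _, inferInstance, ν, fun χ => ?_⟩
  obtain ⟨a, e, he⟩ := h χ
  let f := LinearEquiv.ofFinrankEq C (Fin (Module.finrank K C) → K)
    (Module.finrank_fin_fun K).symm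
  exact ⟨a, _, he.comp (g := μ.prod f.toLinearMap) fun x y hxy => f.injective (congrArg Prod.snd hxy)⟩

/-- The Graham–Leeb–Rothschild theorem, relative to a base space `L`. -/
theorem ramseyOver (K L : Type u) [Field K] [AddCommGroup L] [Module K L] (κ : Type) [Finite K]
    [Finite L] [Finite κ] (k : ℕ) : RamseyOver K L κ k := by
  induction k with
  | zero => exact ramseyOver_of_le_finrank (Nat.zero_le _)
  | succ k ih =>
    by_cases h : k + 1 ≤ Module.finrank K L
    · exact ramseyOver_of_le_finrank h
    · exact ramseyOver_succ (by omega) ih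

end Ramsey

/-! ### The induced theorem over a base -/

section Induced

variable {K L : Type u} [Field K] [AddCommGroup L] [Module K L]

/-- A linear map that agrees with `single e ∘ id` exactly on the part of the copy `e` of `C` lying
over `W`. -/
theorem exists_partial_section {C X : Type u} [AddCommGroup C] [Module K C] [AddCommGroup X]
    [Module K X] {e : C →ₗ[K] X} (he : Function.Injective e) (W : Submodule K C) :
    ∃ p : X →ₗ[K] C, (∀ w ∈ W, p (e w) = w) ∧ ∀ x, p x ∈ W := by
  obtain ⟨g, hg⟩ := LinearMap.exists_leftInverse_of_injective e (LinearMap.ker_eq_bot.2 he)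
  obtain ⟨q, hq⟩ := LinearMap.exists_leftInverse_of_injective W.subtype (Submodule.ker_subtype W)
  refine ⟨W.subtype ∘ₗ q ∘ₗ g, fun w hw => ?_, fun x => (q (g x)).2⟩
  have h1 : g (e w) = w := LinearMap.congr_fun hg w
  have h2 : q w = ⟨w, hw⟩ := LinearMap.congr_fun hq ⟨w, hw⟩
  simp [h1, h2]

/-- The linear maps that agree with no tautological map `e c ↦ single e c` over a `k`-subspace
outside `F`. -/
def avoidingMaps {C X : Type u} [AddCommGroup C] [Module K C] [AddCommGroup X] [Module K X]
    [DecidableEq (C →ₗ[K] X)] (F : Set (Submodule K C)) (k : ℕ) :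
    Set (X →ₗ[K] ((C →ₗ[K] X) → C)) :=
  {s | ∀ e : C →ₗ[K] X, Function.Injective e → ∀ W : Submodule K C, Module.finrank K W = k →
    (∀ w ∈ W, s (e w) = Pi.single e w) → W ∈ F}

/-- The letter retracts onto `W` in coordinate `e` and vanishes in all others. Agreement with the
copy `e` forces a `k`-subspace into `W`, hence equal to it; agreement with another copy forces it to
be zero, which `1 ≤ k` excludes. -/
theorem exists_mem_avoidingMaps {C X : Type u} [AddCommGroup C] [Module K C] [AddCommGroup X]
    [Module K X] [DecidableEq (C →ₗ[K] X)] [FiniteDimensional K C] {F : Set (Submodule K C)}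
    {k : ℕ} (hk : 1 ≤ k) {e : C →ₗ[K] X} (he : Function.Injective e) {W : Submodule K C}
    (hW : W ∈ F) (hWk : Module.finrank K W = k) :
    ∃ s ∈ avoidingMaps F k, ∀ w ∈ W, s (e w) = Pi.single e w := by
  obtain ⟨p, hp, hpW⟩ := exists_partial_section he W
  refine ⟨LinearMap.single K _ e ∘ₗ p, fun e' he' W' hW' h => ?_, fun w hw => by simp [hp w hw]⟩
  by_cases hee : e' = e
  · subst hee
    have hle : W' ≤ W := fun w hw => by
      have h1 : p (e' w) = w := Pi.single_injective e' (h w hw)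
      rw [← h1]
      exact hpW _
    rwa [Submodule.eq_of_le_of_finrank_eq hle (hW'.trans hWk.symm)]
  · have hbot : W' = ⊥ := (Submodule.eq_bot_iff _).2 fun w hw => by
      have h1 := congrFun (h w hw) e'
      simpa [hee] using h1.symm
    subst hbot
    rw [finrank_bot] at hW'
    omega

/-- The induced Ramsey statement over `L`, with an arbitrary finite host space. -/
theorem exists_induced_ramsey [Finite K] [Finite L] {κ : Type} [Finite κ] [Nonempty κ] {C : Type u}
    [AddCommGroup C] [Module K C] [Finite C] (μ : C →ₗ[K] L) (k : ℕ) (F : Set (Submodule K C))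
    (hF : ∀ W ∈ F, W.map μ = ⊤ ∧ Module.finrank K W = k) :
    ∃ (X : Type u) (_ : AddCommGroup X) (_ : Module K X) (_ : Finite X) (ν : X →ₗ[K] L)
      (H : Set (Submodule K X)), (∀ W ∈ H, W.map ν = ⊤ ∧ Module.finrank K W = k) ∧
      ∀ c : H → κ, ∃ e : C →ₗ[K] X, Function.Injective e ∧ ν ∘ₗ e = μ ∧
        (∀ W : Submodule K C, W.map e ∈ H ↔ W ∈ F) ∧
        ∃ a, ∀ (W : Submodule K C) (h : W.map e ∈ H), c ⟨W.map e, h⟩ = a := by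
  classical
  -- For `k = 0` the family has at most the member `⊥`, so `C` is its own host.
  obtain rfl | hk := Nat.eq_zero_or_pos k
  · refine ⟨C, _, _, inferInstance, μ, F, hF, fun c => ⟨LinearMap.id, Function.injective_id, rfl,
      fun W => by rw [Submodule.map_id], ?_⟩⟩
    by_cases hbot : (⊥ : Submodule K C) ∈ F
    · refine ⟨c ⟨⊥, hbot⟩, fun W h => ?_⟩
      congr 2
      exact Submodule.finrank_eq_zero.1 (hF _ h).2
    · refine ⟨Classical.arbitrary κ, fun W h => absurd ?_ hbot⟩
      rwa [Submodule.finrank_eq_zero.1 (hF _ h).2] at h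
  obtain ⟨X, _, _, _, ν, hX⟩ := ramseyOver K L κ k C μ
  obtain ⟨ι, _, hι⟩ := exists_fillPattern_mono (avoidingMaps (X := X) F k) κ
  let H : Set (Submodule K (X × (ι → (C →ₗ[K] X) → C))) :=
    {W | ∃ B : Submodule K X, (B.map ν = ⊤ ∧ Module.finrank K B = k) ∧
      ∃ w : ι → avoidingMaps (X := X) F k,
        W = B.map (LinearMap.id.prod (LinearMap.pi fun i => (w i).1))}
  refine ⟨X × (ι → (C →ₗ[K] X) → C), _, _, inferInstance, ν ∘ₗ LinearMap.fst K X _, H, ?_,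
    fun c => ?_⟩
  · rintro _ ⟨B, ⟨hB, hBk⟩, w, rfl⟩
    refine ⟨?_, ?_⟩
    · rw [← Submodule.map_comp, ← hB]
      rfl
    · rw [finrank_map_of_injective fun x y hxy => congrArg Prod.fst hxy, hBk]
  -- The default colour is never used: only colours of members of `H` are read below.
  obtain ⟨σ, hσ, χ₀, hχ⟩ := hι fun W =>
    if h : W ∈ H then c ⟨W, h⟩ else Classical.arbitrary κ
  obtain ⟨a, e, he⟩ := hX χ₀
  -- The embedding `e` is found only after the line, hence one coordinate of the fibre for every
  -- possible `e`.
  let ε : C →ₗ[K] X × (ι → (C →ₗ[K] X) → C) :=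
    fillPattern σ ∘ₗ e.prod (LinearMap.single K (fun _ : C →ₗ[K] X => C) e)
  have hε : ∀ W ∈ F, ∃ s ∈ avoidingMaps (X := X) F k,
      W.map ε = (W.map e).map (fillPattern σ ∘ₗ LinearMap.id.prod s) := fun W hW => by
    obtain ⟨s, hs, hsW⟩ := exists_mem_avoidingMaps hk he.injective hW (hF W hW).2
    refine ⟨s, hs, ?_⟩
    rw [← Submodule.map_comp]
    refine SetLike.coe_injective (Set.image_congr fun w hw => ?_)
    change fillPattern σ (e w, Pi.single e w) = fillPattern σ (e w, s (e w))
    rw [hsW w hw]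
  have hmem : ∀ W : Submodule K C, W.map ε ∈ H ↔ W ∈ F := by
    refine fun W => ⟨?_, fun hW => ?_⟩
    · rintro ⟨B, ⟨hB, hBk⟩, w, hw⟩
      -- At an active coordinate the letter `w i` agrees with the tautological map on `W`, so its
      -- defining property puts `W` in `F`.
      obtain ⟨i, hi⟩ := hσ
      have hWB : W.map e = B := by
        have := congrArg (Submodule.map (LinearMap.fst K X _)) hw
        rw [← Submodule.map_comp, ← Submodule.map_comp] at this
        exact this.trans (Submodule.map_id B)
      refine (w i).2 e he.injective W ?_ fun x hx => ?_
      · rw [← hBk, ← hWB, finrank_map_of_injective he.injective]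
      · have hx' : ε x ∈ W.map ε := ⟨x, hx, rfl⟩
        rw [hw] at hx'
        obtain ⟨y, -, hy⟩ := hx'
        obtain rfl : y = e x := congrArg Prod.fst hy
        have h2 := congrFun (congrArg Prod.snd hy) i
        have h3 : (ε x).2 i = _ := fillPattern_snd_of_eq_none hi _
        exact h2.trans h3
    · obtain ⟨s, hs, h⟩ := hε W hW
      rw [h]
      refine ⟨W.map e, ⟨?_, ?_⟩, fun i => (σ i).getD ⟨s, hs⟩, ?_⟩
      · rw [← Submodule.map_comp, he.comp_eq, (hF W hW).1]
      · rw [finrank_map_of_injective he.injective, (hF W hW).2]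
      · rw [fillPattern_comp_graph σ ⟨s, hs⟩]
  refine ⟨ε, (fillPattern_injective hσ).comp
    fun x y hxy => he.injective (congrArg Prod.fst hxy), he.comp_eq, hmem, a, fun W h => ?_⟩
  have hW := (hmem W).1 h
  obtain ⟨s, hs, h'⟩ := hε W hW
  have h1 := hχ s hs (W.map e)
  rw [← h', he.color_eq W (hF W hW).1 (hF W hW).2] at h1
  simpa [h] using h1

/-- The induced Ramsey statement over `L`, with a coordinate space as host space. -/
theorem exists_induced_ramsey_fin [Finite K] [Finite L] {κ : Type} [Finite κ] [Nonempty κ]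
    {C : Type u} [AddCommGroup C] [Module K C] [Finite C] (μ : C →ₗ[K] L) (k : ℕ)
    (F : Set (Submodule K C)) (hF : ∀ W ∈ F, W.map μ = ⊤ ∧ Module.finrank K W = k) :
    ∃ (N : ℕ) (ν : (Fin N → K) →ₗ[K] L) (H : Set (Submodule K (Fin N → K))),
      (∀ W ∈ H, W.map ν = ⊤ ∧ Module.finrank K W = k) ∧
      ∀ c : H → κ, ∃ e : C →ₗ[K] (Fin N → K), Function.Injective e ∧ ν ∘ₗ e = μ ∧
        (∀ W : Submodule K C, W.map e ∈ H ↔ W ∈ F) ∧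
        ∃ a, ∀ (W : Submodule K C) (h : W.map e ∈ H), c ⟨W.map e, h⟩ = a := by
  obtain ⟨X, _, _, _, ν, H, hH, hc⟩ := exists_induced_ramsey (κ := κ) μ k F hF
  let ψ : X ≃ₗ[K] (Fin (Module.finrank K X) → K) :=
    LinearEquiv.ofFinrankEq _ _ (Module.finrank_fin_fun K).symm
  have hψ : Function.Injective (Submodule.map ψ.toLinearMap) :=
    Submodule.map_injective_of_injective ψ.injective
  refine ⟨Module.finrank K X, ν ∘ₗ ψ.symm.toLinearMap, Submodule.map ψ.toLinearMap '' H, ?_,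
    fun c => ?_⟩
  · rintro _ ⟨W, hW, rfl⟩
    rw [finrank_map_of_injective ψ.injective, ← Submodule.map_comp, LinearMap.comp_assoc]
    simpa using hH W hW
  · obtain ⟨e, he, hν, hm, a, ha⟩ := hc fun W => c ⟨W.1.map ψ.toLinearMap, W.1, W.2, rfl⟩
    have hm' : ∀ W : Submodule K C,
        W.map (ψ.toLinearMap ∘ₗ e) ∈ Submodule.map ψ.toLinearMap '' H ↔ W.map e ∈ H := fun W => by
      rw [Submodule.map_comp, hψ.mem_set_image]
    refine ⟨ψ.toLinearMap ∘ₗ e, ψ.injective.comp he, ?_, fun W => (hm' W).trans (hm W), a,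
      fun W h => ?_⟩
    · rw [← hν]
      ext
      simp
    · rw [← ha W ((hm' W).1 h)]
      congr 2
      exact Submodule.map_comp _ _ _

end Induced

/-! ### Affine spaces as hyperplane slices -/

section Slice

variable {K Y : Type*} [Field K] [AddCommGroup Y] [Module K Y]

/-- The affine space cut out of the linear space `W` by the hyperplane `μ = 1`. -/
def slice (μ : Y →ₗ[K] K) (W : Submodule K Y) : AffineSubspace K Y where
  carrier := {x | x ∈ W ∧ μ x = 1}
  smul_vsub_vadd_mem' c p₁ p₂ p₃ h₁ h₂ h₃ :=
    ⟨W.add_mem (W.smul_mem c (W.sub_mem h₁.1 h₂.1)) h₃.1, by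
      simp [h₁.2, h₂.2, h₃.2]⟩

theorem mem_slice {μ : Y →ₗ[K] K} {W : Submodule K Y} {x : Y} :
    x ∈ slice μ W ↔ x ∈ W ∧ μ x = 1 := Iff.rfl

theorem slice_mono (μ : Y →ₗ[K] K) {W W' : Submodule K Y} (h : W ≤ W') :
    slice μ W ≤ slice μ W' := fun _ hx => ⟨h hx.1, hx.2⟩

theorem span_slice {μ : Y →ₗ[K] K} {W : Submodule K Y} (hW : W.map μ = ⊤) :
    Submodule.span K (slice μ W : Set Y) = W := by
  refine le_antisymm (Submodule.span_le.2 fun x hx => hx.1) fun w hw => ?_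
  obtain ⟨x, hx, hx1⟩ : (1 : K) ∈ W.map μ := hW ▸ Submodule.mem_top
  have h1 : x ∈ (slice μ W : Set Y) := ⟨hx, hx1⟩
  have h2 : w + (1 - μ w) • x ∈ (slice μ W : Set Y) :=
    ⟨W.add_mem hw (W.smul_mem _ hx), by simp [hx1]⟩
  have := (Submodule.span K (slice μ W : Set Y)).sub_mem (Submodule.subset_span h2)
    (Submodule.smul_mem _ (1 - μ w) (Submodule.subset_span h1))
  simpa using this

/-- The map `y ↦ y - μ y • a` sends `A`, hence its span, into the direction of `A`; at height one it
is `y ↦ y - a`. For empty `A` the span is zero and misses height one. -/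
theorem slice_span {μ : Y →ₗ[K] K} {A : AffineSubspace K Y} (hA : ∀ x ∈ A, μ x = 1) :
    slice μ (Submodule.span K (A : Set Y)) = A := by
  refine le_antisymm (fun x hx => ?_) fun x hx => ⟨Submodule.subset_span hx, hA x hx⟩
  obtain h | ⟨a, ha⟩ := (A : Set Y).eq_empty_or_nonempty
  · rw [mem_slice, h, Submodule.span_empty, Submodule.mem_bot] at hx
    simp [hx.1] at hx
  · let T : Y →ₗ[K] Y := LinearMap.id - μ.smulRight a
    have hT : Submodule.span K (A : Set Y) ≤ A.direction.comap T := by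
      refine Submodule.span_le.2 fun y hy => ?_
      have : T y = y - a := by simp [T, hA y hy]
      rw [SetLike.mem_coe, Submodule.mem_comap, this]
      exact AffineSubspace.vsub_mem_direction hy ha
    have h1 : T x = x - a := by simp [T, hx.2]
    have h2 := hT hx.1
    rw [Submodule.mem_comap, h1] at h2
    simpa using AffineSubspace.vadd_mem_of_mem_direction h2 ha

theorem linearIndependent_of_affineIndependent {ι : Type*} {μ : Y →ₗ[K] K} {b : ι → Y}
    (hμ : ∀ i, μ (b i) = 1) (hb : AffineIndependent K b) : LinearIndependent K b := by
  rw [linearIndependent_iff']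
  intro s w hw i hi
  refine affineIndependent_iff.1 hb s w ?_ hw i hi
  simpa [hμ] using congrArg μ hw

theorem affineIndependent_of_linearIndependent {ι : Type*} {b : ι → Y}
    (hb : LinearIndependent K b) : AffineIndependent K b :=
  affineIndependent_iff.2 fun s w _ hw i hi => linearIndependent_iff'.1 hb s w hw i hi

theorem span_affineSpan_eq (s : Set Y) :
    Submodule.span K (affineSpan K s : Set Y) = Submodule.span K s := by
  refine le_antisymm (Submodule.span_le.2 ?_) (Submodule.span_mono (subset_affineSpan K s))
  have : affineSpan K s ≤ (Submodule.span K s).toAffineSubspace :=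
    affineSpan_le.2 Submodule.subset_span
  exact this

theorem hasAffineRank_slice_iff [FiniteDimensional K Y] {μ : Y →ₗ[K] K} {W : Submodule K Y}
    (hW : W.map μ = ⊤) (k : ℕ) : HasAffineRank K (slice μ W) k ↔ Module.finrank K W = k := by
  constructor
  · rintro ⟨b, hb, hbW⟩
    have hμ : ∀ i, μ (b i) = 1 := fun i => by
      have : b i ∈ slice μ W := hbW ▸ subset_affineSpan K _ ⟨i, rfl⟩
      exact this.2
    rw [← span_slice hW, ← hbW, span_affineSpan_eq,
      finrank_span_eq_card (linearIndependent_of_affineIndependent hμ hb), Fintype.card_fin]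
  · intro hk
    obtain ⟨t, ht, htW, hli⟩ := exists_linearIndependent K (slice μ W : Set Y)
    rw [span_slice hW] at htW
    have : Finite t := hli.finite
    have := Fintype.ofFinite t
    have hcard : Fintype.card t = k := by
      rw [← finrank_span_eq_card hli, Subtype.range_coe, htW, hk]
    let f : Fin k ≃ t := (Fintype.equivFinOfCardEq hcard).symm
    have hr : Set.range (fun i => (f i : Y)) = t := by
      rw [← Function.comp_def, f.surjective.range_comp, Subtype.range_coe]
    refine ⟨fun i => f i, affineIndependent_of_linearIndependent (hli.comp f f.injective), ?_⟩
    rw [hr]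
    have hle : affineSpan K t ≤ slice μ W := affineSpan_le.2 ht
    rw [← slice_span fun x hx => (hle hx).2, span_affineSpan_eq, htW]

theorem slice_map {Z : Type*} [AddCommGroup Z] [Module K Z] {μ : Y →ₗ[K] K} {ν : Z →ₗ[K] K}
    {e : Y →ₗ[K] Z} (h : ν ∘ₗ e = μ) (W : Submodule K Y) :
    slice ν (W.map e) = (slice μ W).map e.toAffineMap := by
  subst h
  ext x
  constructor
  · rintro ⟨⟨w, hw, rfl⟩, hx⟩
    exact ⟨w, ⟨hw, hx⟩, rfl⟩
  · rintro ⟨w, ⟨hw, hx⟩, rfl⟩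
    exact ⟨⟨w, hw, rfl⟩, hx⟩

end Slice

/-! ### Barycentric coordinates -/

section Barycentric

variable {K V : Type*} [Field K] [AddCommGroup V] [Module K V]

/-- The sum of the coordinates. -/
def coordSum (K : Type*) [Field K] (n : ℕ) : (Fin n → K) →ₗ[K] K := ∑ i, LinearMap.proj i

theorem coordSum_single (n : ℕ) (i : Fin n) : coordSum K n (Pi.single i 1) = 1 := by
  simp [coordSum]

/-- Barycentric coordinates with respect to affinely independent points, extended to an affine map
on the surrounding space. -/
theorem exists_barycentric {n : ℕ} {b : Fin n → V} (hb : AffineIndependent K b) :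
    ∃ β : V →ᵃ[K] (Fin n → K),
      Set.InjOn β (affineSpan K (Set.range b) : Set V) ∧
      (affineSpan K (Set.range b)).map β = slice (coordSum K n) ⊤ := by
  -- Lifting the points to height one turns affine into linear independence, so the coordinates come
  -- from a linear left inverse.
  have hli : LinearIndependent K fun i => ((b i, 1) : V × K) := by
    refine linearIndependent_of_affineIndependent (μ := LinearMap.snd K V K) (fun i => rfl) ?_
    exact AffineIndependent.of_comp (LinearMap.fst K V K).toAffineMap hb
  obtain ⟨g, hg⟩ := LinearMap.exists_leftInverse_of_injective
    (Fintype.linearCombination K fun i => ((b i, 1) : V × K))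
    (LinearMap.ker_eq_bot.2 (hli.fintypeLinearCombination_injective))
  let β : V →ᵃ[K] (Fin n → K) :=
    g.toAffineMap.comp ((AffineMap.id K V).prod (AffineMap.const K V (1 : K)))
  have hβ : ∀ i, β (b i) = Pi.single i 1 := fun i => by
    have := LinearMap.congr_fun hg (Pi.single i 1)
    rw [LinearMap.comp_apply, Fintype.linearCombination_apply_single, one_smul] at this
    exact this
  let α : (Fin n → K) →ₗ[K] V := Fintype.linearCombination K b
  have hα : ∀ i, α (β (b i)) = b i := fun i => by
    rw [hβ]
    simp [α, Fintype.linearCombination_apply_single]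
  have hαβ : Set.EqOn (α.toAffineMap.comp β) (AffineMap.id K V)
      (affineSpan K (Set.range b) : Set V) := by
    intro x hx
    refine affineSpan_induction (p := fun x => α.toAffineMap.comp β x = AffineMap.id K V x) hx ?_
      fun c u v w hu hv hw => ?_
    · rintro _ ⟨i, rfl⟩
      exact hα i
    · rw [AffineMap.map_vadd, AffineMap.map_vadd, hw, map_smul, map_smul, AffineMap.linearMap_vsub,
        AffineMap.linearMap_vsub, hu, hv]
  refine ⟨β, fun x hx y hy hxy => ?_, ?_⟩
  · have h1 := hαβ hx
    have h2 := hαβ hy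
    simp only [AffineMap.comp_apply, hxy, AffineMap.id_apply] at h1 h2
    exact h1.symm.trans h2
  · rw [AffineSubspace.map_span, ← Set.range_comp]
    have hfun : β ∘ b = fun i => Pi.single i 1 := funext hβ
    rw [hfun]
    have hle : affineSpan K (Set.range fun i : Fin n => (Pi.single i 1 : Fin n → K)) ≤
        slice (coordSum K n) ⊤ := affineSpan_le.2 (by
      rintro _ ⟨i, rfl⟩
      exact ⟨trivial, coordSum_single n i⟩)
    rw [← slice_span fun x hx => (hle hx).2, span_affineSpan_eq]
    congr 1
    have := (Pi.basisFun K (Fin n)).span_eq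
    rwa [show ⇑(Pi.basisFun K (Fin n)) = fun i => Pi.single i 1 from
      funext fun i => Pi.basisFun_apply K (Fin n) i] at this

end Barycentric

/-! ### The vector and affine theorems -/

theorem vector_induced_ramsey {K : Type u} [Field K] [Finite K] (k n r : ℕ) (hr : 1 ≤ r)
    (C : Type v) [AddCommGroup C] [Module K C] (hC : Module.rank K C = (n : Cardinal))
    (F : Set (Submodule K C)) (hF : F ⊆ vectorSubspaces K ⊤ k) :
    ∃ (N : ℕ) (H : Set (Submodule K (Fin N → K))),
      H ⊆ vectorSubspaces K ⊤ k ∧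
      ∀ c : H → Fin r, ∃ U ∈ vectorSubspaces K (⊤ : Submodule K (Fin N → K)) n,
        IsMonochromaticOn c (vectorSubspaces K U k ∩ H) ∧
        ∃ φ : C ≃ₗ[K] U,
          (fun W : Submodule K C => W.map (U.subtype ∘ₗ φ.toLinearMap)) '' F =
            vectorSubspaces K U k ∩ H := by
  have : Nonempty (Fin r) := ⟨⟨0, hr⟩⟩
  have hfd : FiniteDimensional K C := by
    rw [FiniteDimensional, ← Module.rank_lt_aleph0_iff, hC]
    exact Cardinal.natCast_lt_aleph0
  have hn : Module.finrank K C = n := Module.finrank_eq_of_rank_eq hC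
  -- Coordinates also bring `C` into the universe of `K`.
  let ψ : C ≃ₗ[K] (Fin n → K) := LinearEquiv.ofFinrankEq _ _ (by
    rw [hn, Module.finrank_fin_fun])
  have hψ : Function.Injective (Submodule.map ψ.toLinearMap) :=
    Submodule.map_injective_of_injective ψ.injective
  -- The base is the zero space, so mapping onto it is no condition.
  obtain ⟨N, ν, H, hH, hc⟩ := exists_induced_ramsey_fin (κ := Fin r)
    (0 : (Fin n → K) →ₗ[K] (Fin 0 → K)) k (Submodule.map ψ.toLinearMap '' F) (by
      rintro _ ⟨W, hW, rfl⟩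
      refine ⟨Subsingleton.elim _ _, ?_⟩
      rw [finrank_map_of_injective ψ.injective]
      exact Module.finrank_eq_of_rank_eq (hF hW).2)
  refine ⟨N, H, fun W hW => ⟨le_top, ?_⟩, fun c => ?_⟩
  · rw [← (hH W hW).2, Module.finrank_eq_rank]
  obtain ⟨e, he, -, hm, a, ha⟩ := hc c
  have hlift : ∀ W ∈ H, W ≤ LinearMap.range e → ∃ W₁ ∈ F, W = (W₁.map ψ.toLinearMap).map e := by
    intro W hW hle
    have h1 : (W.comap e).map e = W := Submodule.map_comap_eq_self hle
    rw [← h1] at hW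
    obtain ⟨W₁, hW₁, h2⟩ := (hm _).1 hW
    exact ⟨W₁, hW₁, by rw [h2, h1]⟩
  refine ⟨LinearMap.range e, ⟨le_top, ?_⟩, ⟨a, ?_⟩, ψ.trans (LinearEquiv.ofInjective e he), ?_⟩
  · rw [← Module.finrank_eq_rank, LinearMap.finrank_range_of_inj he, Module.finrank_fin_fun]
  · rintro ⟨W, hW⟩ ⟨⟨hle, -⟩, -⟩
    obtain ⟨W₁, hW₁, rfl⟩ := hlift W hW hle
    exact ha _ hW
  · have hcomp : (LinearMap.range e).subtype ∘ₗ
        (ψ.trans (LinearEquiv.ofInjective e he)).toLinearMap = e ∘ₗ ψ.toLinearMap := rfl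
    rw [hcomp]
    ext W
    constructor
    · rintro ⟨W, hW, rfl⟩
      have hWH : (W.map ψ.toLinearMap).map e ∈ H := (hm _).2 ⟨W, hW, rfl⟩
      simp only [Submodule.map_comp]
      refine ⟨⟨LinearMap.map_le_range, ?_⟩, hWH⟩
      rw [← (hH _ hWH).2, Module.finrank_eq_rank]
    · rintro ⟨⟨hle, -⟩, hW⟩
      obtain ⟨W₁, hW₁, rfl⟩ := hlift W hW hle
      exact ⟨W₁, hW₁, Submodule.map_comp _ _ _⟩

/-- The unique affine space of rank `0` is the empty one. -/
theorem hasAffineRank_zero_iff {K V : Type*} [Field K] [AddCommGroup V] [Module K V]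
    {W : AffineSubspace K V} : HasAffineRank K W 0 ↔ W = ⊥ := by
  constructor
  · rintro ⟨b, -, rfl⟩
    simp
  · rintro rfl
    exact ⟨Fin.elim0, affineIndependent_of_subsingleton K _, by simp⟩

theorem HasAffineRank.nonempty {K V : Type*} [Field K] [AddCommGroup V] [Module K V]
    {W : AffineSubspace K V} {k : ℕ} (hk : 1 ≤ k) (h : HasAffineRank K W k) : ∃ x, x ∈ W := by
  obtain ⟨b, -, rfl⟩ := h
  exact ⟨b ⟨0, hk⟩, subset_affineSpan K _ ⟨_, rfl⟩⟩

theorem map_eq_top_of_mem {K Y : Type*} [Field K] [AddCommGroup Y] [Module K Y] {μ : Y →ₗ[K] K}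
    {W : Submodule K Y} {x : Y} (hx : x ∈ W) (hμ : μ x = 1) : W.map μ = ⊤ :=
  (eq_bot_or_eq_top (W.map μ)).resolve_left fun h => by
    have : μ x ∈ W.map μ := ⟨x, hx, rfl⟩
    simp [h, hμ] at this

theorem HasAffineRank.map {K V V' : Type*} [Field K] [AddCommGroup V] [Module K V] [AddCommGroup V']
    [Module K V'] {φ : V →ᵃ[K] V'} {W : AffineSubspace K V} {k : ℕ}
    (hφ : Set.InjOn φ (W : Set V)) (h : HasAffineRank K W k) : HasAffineRank K (W.map φ) k := by
  obtain rfl | hk := Nat.eq_zero_or_pos k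
  · rw [hasAffineRank_zero_iff] at h ⊢
    rw [h, AffineSubspace.map_bot]
  obtain ⟨x, hx⟩ := h.nonempty hk
  have : Nonempty W := ⟨⟨x, hx⟩⟩
  obtain ⟨b, hb, hbW⟩ := h
  have hmem : ∀ i, b i ∈ W := fun i => hbW ▸ subset_affineSpan K _ ⟨i, rfl⟩
  have hb' : AffineIndependent K fun i => (⟨b i, hmem i⟩ : W) :=
    AffineIndependent.of_comp W.subtype hb
  refine ⟨φ ∘ b, hb'.map' (φ.comp W.subtype) fun x y hxy => Subtype.ext (hφ x.2 y.2 hxy), ?_⟩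
  rw [Set.range_comp, ← AffineSubspace.map_span, hbW]

theorem affine_induced_ramsey {K : Type u} [Field K] [Finite K] (k n r : ℕ) (hkn : k ≤ n)
    (hr : 1 ≤ r) (V : Type v) [AddCommGroup V] [Module K V] (C : AffineSubspace K V)
    (hC : HasAffineRank K C n) (F : Set (AffineSubspace K V)) (hF : F ⊆ affineSubspaces K C k) :
    ∃ (N : ℕ) (X : AffineSubspace K (Fin N → K)) (H : Set (AffineSubspace K (Fin N → K))),
      HasAffineRank K X N ∧ H ⊆ affineSubspaces K X k ∧
      ∀ c : H → Fin r, ∃ U ∈ affineSubspaces K X n,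
        IsMonochromaticOn c (affineSubspaces K U k ∩ H) ∧
        ∃ φ : V →ᵃ[K] (Fin N → K), IsAffineIsoOn K φ C U ∧
          (fun W : AffineSubspace K V => W.map φ) '' F = affineSubspaces K U k ∩ H := by
  have : Nonempty (Fin r) := ⟨⟨0, hr⟩⟩
  obtain ⟨b, hb, rfl⟩ := id hC
  obtain ⟨β, hβ, hβC⟩ := exists_barycentric hb
  set C := affineSpan K (Set.range b)
  -- The empty affine space spans zero, which does not map onto `K`, so `k = 0` is settled
  -- separately with a copy of `C` as host.
  obtain rfl | hk := Nat.eq_zero_or_pos k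
  · refine ⟨n, C.map β, (fun W => W.map β) '' F, hC.map hβ, ?_, fun c => ⟨C.map β,
      ⟨le_rfl, hC.map hβ⟩, ?_, β, ⟨hβ, rfl⟩, ?_⟩⟩
    · rintro _ ⟨W, hW, rfl⟩
      exact ⟨AffineSubspace.map_mono β (hF hW).1, (hF hW).2.map (hβ.mono (hF hW).1)⟩
    · by_cases hbot : (⊥ : AffineSubspace K (Fin n → K)) ∈ (fun W => W.map β) '' F
      · refine ⟨c ⟨⊥, hbot⟩, fun W hW => ?_⟩
        congr 1
        exact Subtype.ext (hasAffineRank_zero_iff.1 hW.1.2)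
      · refine ⟨Classical.arbitrary _, fun W hW => absurd ?_ hbot⟩
        rw [← hasAffineRank_zero_iff.1 hW.1.2]
        exact W.2
    · refine (Set.inter_eq_right.2 ?_).symm
      rintro _ ⟨W, hW, rfl⟩
      exact ⟨AffineSubspace.map_mono β (hF hW).1, (hF hW).2.map (hβ.mono (hF hW).1)⟩
  have hμtop : (⊤ : Submodule K (Fin n → K)).map (coordSum K n) = ⊤ :=
    map_eq_top_of_mem trivial (coordSum_single n ⟨0, by omega⟩)
  let Fhat : Set (Submodule K (Fin n → K)) :=
    {W | (W.map (coordSum K n) = ⊤ ∧ Module.finrank K W = k) ∧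
      ∃ A ∈ F, A.map β = slice (coordSum K n) W}
  obtain ⟨N, ν, H, hH, hc⟩ := exists_induced_ramsey_fin (κ := Fin r) (coordSum K n) k Fhat
    fun W hW => hW.1
  -- Any colouring yields an embedding over `K`, and the image of a unit vector has height one.
  have hνtop : (⊤ : Submodule K (Fin N → K)).map ν = ⊤ := by
    obtain ⟨e, -, he, -⟩ := hc fun _ => Classical.arbitrary _
    refine map_eq_top_of_mem (x := e (Pi.single ⟨0, by omega⟩ 1)) trivial ?_
    rw [← LinearMap.comp_apply, he, coordSum_single]
  have hFhat : ∀ A ∈ F, ∃ W ∈ Fhat, A.map β = slice (coordSum K n) W := fun A hA => by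
    have hmem : ∀ x ∈ A.map β, coordSum K n x = 1 := fun x hx => by
      have h1 := AffineSubspace.map_mono β (hF hA).1 hx
      rw [hβC] at h1
      exact h1.2
    have hrank : HasAffineRank K (A.map β) k := (hF hA).2.map (hβ.mono (hF hA).1)
    obtain ⟨x, hx⟩ := hrank.nonempty hk
    have htop := map_eq_top_of_mem (Submodule.subset_span hx) (hmem x hx)
    have hslice := (slice_span hmem).symm
    refine ⟨Submodule.span K (A.map β : Set (Fin n → K)), ⟨⟨htop, ?_⟩, A, hA, hslice⟩, hslice⟩
    rwa [← hasAffineRank_slice_iff htop, ← hslice]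
  refine ⟨N, slice ν ⊤, slice ν '' H, (hasAffineRank_slice_iff hνtop N).2 (by simp), ?_,
    fun c => ?_⟩
  · rintro _ ⟨W, hW, rfl⟩
    exact ⟨slice_mono ν le_top, (hasAffineRank_slice_iff (hH W hW).1 k).2 (hH W hW).2⟩
  obtain ⟨e, he, hν, hm, a, ha⟩ := hc fun W => c ⟨slice ν W.1, W.1, W.2, rfl⟩
  have hrange : (LinearMap.range e).map ν = ⊤ := by
    rw [← LinearMap.range_comp, hν, LinearMap.range_eq_map, hμtop]
  -- Slices span their linear spaces, so inclusion of slices gives inclusion of the spaces.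
  have hlift : ∀ W ∈ H, slice ν W ≤ slice ν (LinearMap.range e) →
      ∃ W₁ ∈ Fhat, W = W₁.map e := by
    intro W hW hle
    have h1 : (W.comap e).map e = W := Submodule.map_comap_eq_self (by
      rw [← span_slice (hH W hW).1, ← span_slice hrange]
      exact Submodule.span_mono hle)
    exact ⟨W.comap e, (hm _).1 (h1.symm ▸ hW), h1.symm⟩
  refine ⟨slice ν (LinearMap.range e), ⟨slice_mono ν le_top, ?_⟩, ⟨a, ?_⟩,
    e.toAffineMap.comp β, ⟨?_, ?_⟩, ?_⟩
  · rw [hasAffineRank_slice_iff hrange, LinearMap.finrank_range_of_inj he, Module.finrank_fin_fun]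
  · rintro ⟨_, W, hW, rfl⟩ ⟨⟨hle, -⟩, -⟩
    obtain ⟨W₁, hW₁, rfl⟩ := hlift W hW hle
    exact ha _ hW
  · exact fun x hx y hy hxy => hβ hx hy (he hxy)
  · rw [← AffineSubspace.map_map, hβC, ← slice_map hν, LinearMap.range_eq_map]
  · ext A
    constructor
    · rintro ⟨A, hA, rfl⟩
      obtain ⟨W, hW, hAW⟩ := hFhat A hA
      have hWH := (hm W).2 hW
      have h1 : A.map (e.toAffineMap.comp β) = slice ν (W.map e) := by
        rw [← AffineSubspace.map_map, hAW, ← slice_map hν]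
      refine ⟨⟨?_, ?_⟩, W.map e, hWH, h1.symm⟩
      · exact h1.trans_le (slice_mono ν LinearMap.map_le_range)
      · have h2 := (hasAffineRank_slice_iff (hH _ hWH).1 k).2 (hH _ hWH).2
        rwa [← h1] at h2
    · rintro ⟨⟨hle, -⟩, W, hW, rfl⟩
      obtain ⟨W₁, ⟨-, A, hA, hAW⟩, rfl⟩ := hlift W hW hle
      refine ⟨A, hA, ?_⟩
      simp only [← AffineSubspace.map_map, hAW, ← slice_map hν]

end SpaceRamsey

theorem theorem1p2 {K : Type*} [Field K] [Finite K]
    (k n r : ℕ) (hkn : k ≤ n) (hr : 1 ≤ r) :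
    -- the version for vector spaces
    (∀ (C : Type*) [AddCommGroup C] [Module K C], Module.rank K C = (n : Cardinal) →
      ∀ F : Set (Submodule K C), F ⊆ SpaceRamsey.vectorSubspaces K ⊤ k →
      ∃ (N : ℕ) (H : Set (Submodule K (Fin N → K))),
        H ⊆ SpaceRamsey.vectorSubspaces K ⊤ k ∧
        ∀ c : H → Fin r, ∃ U ∈ SpaceRamsey.vectorSubspaces K (⊤ : Submodule K (Fin N → K)) n,
          SpaceRamsey.IsMonochromaticOn c (SpaceRamsey.vectorSubspaces K U k ∩ H) ∧
          ∃ φ : C ≃ₗ[K] U,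
            (fun W : Submodule K C => W.map (U.subtype ∘ₗ φ.toLinearMap)) '' F =
              SpaceRamsey.vectorSubspaces K U k ∩ H) ∧
    -- the version for affine spaces
    (∀ (V : Type*) [AddCommGroup V] [Module K V] (C : AffineSubspace K V),
      SpaceRamsey.HasAffineRank K C n →
      ∀ F : Set (AffineSubspace K V), F ⊆ SpaceRamsey.affineSubspaces K C k →
      ∃ (N : ℕ) (X : AffineSubspace K (Fin N → K)) (H : Set (AffineSubspace K (Fin N → K))),
        SpaceRamsey.HasAffineRank K X N ∧
        H ⊆ SpaceRamsey.affineSubspaces K X k ∧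
        ∀ c : H → Fin r, ∃ U ∈ SpaceRamsey.affineSubspaces K X n,
          SpaceRamsey.IsMonochromaticOn c (SpaceRamsey.affineSubspaces K U k ∩ H) ∧
          ∃ φ : V →ᵃ[K] (Fin N → K), SpaceRamsey.IsAffineIsoOn K φ C U ∧
            (fun W : AffineSubspace K V => W.map φ) '' F =
              SpaceRamsey.affineSubspaces K U k ∩ H) := by
  refine ⟨fun C _ _ hC F hF => ?_, fun V _ _ C hC F hF => ?_⟩
  · exact SpaceRamsey.vector_induced_ramsey k n r hr C hC F hF
  · exact SpaceRamsey.affine_induced_ramsey k n r hkn hr V C hC F hF
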